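/- Let $G$ be a finite group which is abelian or has odd order. For an integer $a$ (of any sign) with $\gcd(a,|G|)=1$, let $\left(\frac{a}{G}\right)_{el}\in\{1,-1\}$ be the signature of the permutation $\rho_a\colon G\to G$, $g\mapsto g^a$, of the elements of $G$. Put $f_2(G)=\{g\in G: g^2=1\}$, let $n_2(G)$ be the number of Sylow $2$-subgroups of $G$, let $\epsilon(G)=1$ if $|G|=2\,n_2(G)$ and $\epsilon(G)=0$ otherwise, and define the integer $$d_G=(-1)^{\frac{|G|-|f_2(G)|}{2}}\,\frac{|G|^{|f_2(G)|}}{n_2(G)^{\epsilon(G)}}.$$ Then, for every integer $a$ with $\gcd(a,|G|)=1$, $$\left(\frac{a}{G}\right)_{el}=\left(\frac{d_G}{a}\right),$$ where $\left(\frac{n}{a}\right)$ is the Kronecker symbol: the extension of the Legendre symbol to all integers $n,a$ that is multiplicative in $a$, with $\left(\frac{n}{1}\right)=1$; $\left(\frac{n}{-1}\right)=-1$ if $n<0$ and $1$ if $n\ge 0$; $\left(\frac{n}{2}\right)=0$ if $n$ is even, $1$ if $n\equiv 1,7\pmod 8$ and $-1$ if $n\equiv 3,5\pmod 8$; and $\left(\frac{n}{0}\right)=1$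 if $n=1$ and $0$ otherwise. -/

import Mathlib

/-- The power permutation `ρ_a : G → G`, `g ↦ g ^ a`, of a finite group `G`, for an integer `a`
(of any sign) coprime to the order of `G`. -/
noncomputable def powPerm {G : Type*} [Group G] [Finite G] (a : ℤ)
    (ha : IsCoprime a (Nat.card G : ℤ)) : Equiv.Perm G where
  toFun g := g ^ a
  invFun g := g ^ (Int.gcdA a (Nat.card G))
  left_inv g := by
    have hb : (1 : ℤ) = a * Int.gcdA a (Nat.card G) + Nat.card G * Int.gcdB a (Nat.card G) := by
      rw [← Int.gcd_eq_gcd_ab, Int.isCoprime_iff_gcd_eq_one.mp ha, Nat.cast_one]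
    calc (g ^ a) ^ Int.gcdA a (Nat.card G)
        = g ^ (a * Int.gcdA a (Nat.card G) + Nat.card G * Int.gcdB a (Nat.card G)) := by
          rw [zpow_add, zpow_mul, zpow_mul, zpow_natCast, pow_card_eq_one', one_zpow, mul_one]
      _ = g := by rw [← hb, zpow_one]
  right_inv g := by
    have hb : (1 : ℤ) = a * Int.gcdA a (Nat.card G) + Nat.card G * Int.gcdB a (Nat.card G) := by
      rw [← Int.gcd_eq_gcd_ab, Int.isCoprime_iff_gcd_eq_one.mp ha, Nat.cast_one]
    calc (g ^ Int.gcdA a (Nat.card G)) ^ a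
        = g ^ (a * Int.gcdA a (Nat.card G) + Nat.card G * Int.gcdB a (Nat.card G)) := by
          rw [zpow_add, mul_comm a, zpow_mul, zpow_mul, zpow_natCast, pow_card_eq_one', one_zpow,
            mul_one]
      _ = g := by rw [← hb, zpow_one]

/-- The symbol `(a / G)_el`: the signature of the permutation `g ↦ g ^ a` of the elements of `G`. -/
noncomputable def elemSymbol (G : Type*) [Group G] [Fintype G] [DecidableEq G] (a : ℤ)
    (ha : IsCoprime a (Nat.card G : ℤ)) : ℤ :=
  ((Equiv.Perm.sign (powPerm (G := G) a ha) : ℤˣ) : ℤ)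

/-- The Kronecker symbol `(n / a)` of two integers: for `a ≠ 0` write `a = ± 2 ^ v * m` with `m` odd
and positive; then `(n / a) = (n / ±1) * (n / 2) ^ v * (n / m)`, where `(n / 1) = 1`,
`(n / -1)` is `-1` if `n < 0` and `1` otherwise, `(n / 2) = χ₈ n` is `0` for even `n`, `1` for
`n ≡ 1, 7` and `-1` for `n ≡ 3, 5` modulo `8`, and `(n / m)` is the Jacobi symbol.
Moreover `(n / 0)` is `1` if `n = 1` and `0` otherwise. -/
def kroneckerSym (n a : ℤ) : ℤ :=
  if a = 0 then (if n = 1 then 1 else 0)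
  else (if a < 0 ∧ n < 0 then -1 else 1) *
    (ZMod.χ₈ (n : ZMod 8)) ^ padicValNat 2 a.natAbs *
    jacobiSym n (a.natAbs / 2 ^ padicValNat 2 a.natAbs)

/-- `f_m(G)`, the set of solutions of `g ^ m = 1` in `G`. -/
def powKernel (G : Type*) [Group G] (m : ℕ) : Set G := {g : G | g ^ m = 1}

/-- `n_2(G)`, the number of Sylow 2-subgroups of `G`. -/
noncomputable def numSylowTwo (G : Type*) [Group G] : ℕ := Nat.card (Sylow 2 G)

/-- `ε(G)` is `1` if `|G| = 2 n_2(G)`, and `0` otherwise. -/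
noncomputable def epsTwo (G : Type*) [Group G] : ℕ :=
  if Nat.card G = 2 * numSylowTwo G then 1 else 0

/-- `d_G = (-1) ^ ((|G| - |f_2(G)|) / 2) * |G| ^ |f_2(G)| / n_2(G) ^ ε(G)`. For a finite group the
subtraction and both divisions are exact, see the two facts below. -/
noncomputable def powDisc (G : Type*) [Group G] : ℤ :=
  (-1) ^ ((Nat.card G - (powKernel G 2).ncard) / 2) *
    (((Nat.card G ^ (powKernel G 2).ncard) / (numSylowTwo G ^ epsTwo G) : ℕ) : ℤ)

theorem exists_card_eq_powKernel_two (G : Type*) [Group G] [Finite G] :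
    ∃ k : ℕ, Nat.card G = (powKernel G 2).ncard + 2 * k := by
  classical
  have := Fintype.ofFinite G
  have hf : (Equiv.inv G) ^ 2 ^ 1 = 1 := by
    ext g
    simp [pow_two]
  have h1 := Equiv.Perm.card_compl_support_modEq (p := 2) hf
  have h2 : powKernel G 2 = ((Equiv.inv G).supportᶜ : Finset G) := by
    ext g
    simp [powKernel, pow_two, inv_eq_iff_mul_eq_one]
  have h3 : (powKernel G 2).ncard ≤ Nat.card G := Set.ncard_le_card _
  rw [← Set.ncard_coe_finset, ← h2, ← Nat.card_eq_fintype_card] at h1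
  obtain ⟨k, hk⟩ := (Nat.modEq_iff_dvd' h3).mp h1
  exact ⟨k, by omega⟩

theorem numSylowTwo_dvd (G : Type*) [Group G] [Finite G] :
    numSylowTwo G ^ epsTwo G ∣ Nat.card G ^ (powKernel G 2).ncard := by
  have h1 : (powKernel G 2).ncard ≠ 0 := by
    have h : (1 : G) ∈ powKernel G 2 := by simp [powKernel]
    exact Set.ncard_ne_zero_of_mem h
  have h2 : numSylowTwo G ^ epsTwo G ∣ Nat.card G := by
    unfold epsTwo
    split_ifs with h
    · rw [pow_one]; exact ⟨2, by rw [h, mul_comm]⟩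
    · simp
  exact h2.trans (dvd_pow_self _ h1)

open Equiv

/-! Both symbols depend only on `a` modulo |G| when |G| is odd, and modulo 4|G| when it is even, so
by Dirichlet's theorem `a` may be taken to be an odd prime p not dividing |G|.

Let X be the character table of G over an algebraic closure of F_p, z_C the centralizer orders, and
ι, τ the permutations of the conjugacy classes induced by g ↦ g⁻¹ and g ↦ g^p. Column orthogonality
gives (det X)² = sgn(ι) ∏ z_C. Frobenius on the entries realizes τ on the columns, so (det X)^p =
sgn(τ) det X. Euler's criterion then says that sgn(τ) is the Legendre symbol of sgn(ι) ∏ z_C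
(`legendreSym_eq_sign_of_conjClasses`).

The hypothesis on G serves twice. Its inner automorphism group has odd order, so signs on classes
equal signs on elements (`ConjClasses.sign_congrPerm`); and ∏ z_C has the same Legendre symbol as
|G|^|G| (`legendreSym_prod_centralizerCard`). Since |G| and |f_2(G)| have the same parity, d_G
results. -/

/-! ### Signs of permutations and actions of groups of odd order -/

theorem Nat.card_eq_of_surjective_of_ker_eq {X A B : Type*} {f : X → A} {g : X → B}
    (hf : Function.Surjective f) (hg : Function.Surjective g)
    (h : ∀ x y, f x = f y ↔ g x = g y) : Nat.card A = Nat.card B := by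
  have hs : Setoid.ker f = Setoid.ker g := Setoid.ext h
  refine Nat.card_congr ((Setoid.quotientKerEquivOfSurjective f hf).symm.trans ?_)
  rw [hs]
  exact Setoid.quotientKerEquivOfSurjective g hg

/-- Y is the orbit set, and each orbit has odd size because its size divides |H|. -/
theorem MulAction.card_modEq_two_of_odd {H X Y : Type*} [Group H] [MulAction H X] [Finite X]
    (hH : Odd (Nat.card H)) {π : X → Y} (hπ : Function.Surjective π)
    (h : ∀ x y, π x = π y ↔ ∃ c : H, c • x = y) : Nat.card X ≡ Nat.card Y [MOD 2] := by
  classical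
  have : Finite H := Nat.finite_of_card_ne_zero hH.pos.ne'
  have := Fintype.ofFinite X
  have hY : Nat.card Y = Nat.card (MulAction.orbitRel.Quotient H X) := by
    refine Nat.card_eq_of_surjective_of_ker_eq hπ Quotient.mk_surjective fun x y ↦ ?_
    rw [h, Quotient.eq, MulAction.orbitRel_apply, MulAction.mem_orbit_symm]
    rfl
  have := Fintype.ofFinite (MulAction.orbitRel.Quotient H X)
  rw [hY, Nat.card_congr (MulAction.selfEquivSigmaOrbits H X), Nat.card_sigma,
    Nat.card_eq_fintype_card, Fintype.card, Finset.card_eq_sum_ones]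
  refine Nat.ModEq.sum fun ω _ ↦ ?_
  have hdvd : Nat.card (MulAction.orbit H ω.out) ∣ Nat.card H := by
    rw [Nat.card_congr (MulAction.orbitEquivQuotientStabilizer H ω.out)]
    exact Subgroup.card_quotient_dvd_card _
  exact Nat.odd_iff.mp (hH.of_dvd_nat hdvd)

theorem Equiv.Perm.sign_eq_neg_one_pow_card_add_card {X : Type*} [Fintype X] [DecidableEq X]
    (σ : Perm X) :
    Perm.sign σ = (-1) ^ (Nat.card X + Nat.card (Quotient (Perm.SameCycle.setoid σ))) := by
  classical
  have hq : Nat.card (Quotient (Perm.SameCycle.setoid σ)) =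
      σ.cycleType.card + (Finset.univ \ σ.support).card := by
    let f : X → σ.cycleFactorsFinset ⊕ {x // x ∈ Finset.univ \ σ.support} := fun x ↦
      if hx : x ∈ σ.support then
        .inl ⟨σ.cycleOf x, Perm.cycleOf_mem_cycleFactorsFinset_iff.mpr hx⟩
      else .inr ⟨x, by simpa using hx⟩
    have hf : Function.Surjective f := by
      rintro (⟨c, hc⟩ | ⟨x, hx⟩)
      · obtain ⟨x, hx⟩ := (Perm.mem_cycleFactorsFinset_iff.mp hc).1.nonempty_support
        refine ⟨x, ?_⟩
        have hxσ : x ∈ σ.support := Perm.mem_cycleFactorsFinset_support_le hc hx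
        simp only [f, dif_pos hxσ]
        exact congrArg Sum.inl (Subtype.ext
          ((Perm.eq_cycleOf_of_mem_cycleFactorsFinset_iff σ c hc x).mpr hx).symm)
      · have hxσ : x ∉ σ.support := (Finset.mem_sdiff.mp hx).2
        exact ⟨x, by simp only [f, dif_neg hxσ]⟩
    rw [Nat.card_eq_of_surjective_of_ker_eq Quotient.mk_surjective hf fun x y ↦ ?_]
    · rw [Nat.card_sum, Nat.card_eq_fintype_card, Nat.card_eq_fintype_card, Fintype.card_coe,
        Fintype.card_coe, Perm.cycleType_def, Multiset.card_map, Finset.card_def]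
    · rw [Quotient.eq]
      change σ.SameCycle x y ↔ _
      by_cases hx : x ∈ σ.support <;> by_cases hy : y ∈ σ.support
      · simp only [f, dif_pos hx, dif_pos hy, Sum.inl.injEq, Subtype.mk.injEq]
        exact Perm.sameCycle_iff_cycleOf_eq_of_mem_support hx hy
      · simp only [f, dif_pos hx, dif_neg hy, reduceCtorEq, iff_false]
        exact fun h ↦ hy (h.mem_support_iff.mp hx)
      · simp only [f, dif_neg hx, dif_pos hy, reduceCtorEq, iff_false]
        exact fun h ↦ hx (h.mem_support_iff.mpr hy)
      · simp only [f, dif_neg hx, dif_neg hy, Sum.inr.injEq, Subtype.mk.injEq]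
        exact ⟨fun h ↦ h.eq_of_left (Perm.notMem_support.mp hx), fun h ↦ h ▸ .refl _ _⟩
  rw [Perm.sign_of_cycleType, hq, Perm.sum_cycleType, Nat.card_eq_fintype_card, ← Finset.card_univ,
    ← Finset.card_sdiff_add_card_eq_card (Finset.subset_univ σ.support), pow_add, pow_add, pow_add,
    pow_add]
  generalize (Finset.univ \ σ.support).card = u
  -- Fixed points count once as points and once as cycles, so they cancel.
  rcases Nat.even_or_odd u with hu | hu <;> simp [hu.neg_one_pow]

/-- H also permutes the cycles of σ, and the orbits of cycles correspond to the cycles of τ. So the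
number of points and the number of cycles both keep their parity in passing from X to Y, and these
determine the sign. -/
theorem Equiv.Perm.sign_eq_sign_of_odd_action {H X Y : Type*} [Group H] [MulAction H X]
    [Fintype X] [DecidableEq X] [Fintype Y] [DecidableEq Y] (hH : Odd (Nat.card H))
    {π : X → Y} (hπ : Function.Surjective π) (h : ∀ x y, π x = π y ↔ ∃ c : H, c • x = y)
    {σ : Perm X} {τ : Perm Y} (hσ : ∀ (c : H) x, σ (c • x) = c • σ x)
    (hστ : ∀ x, π (σ x) = τ (π x)) : Perm.sign σ = Perm.sign τ := by
  have hσz : ∀ (i : ℤ) (c : H) x, (σ ^ i) (c • x) = c • (σ ^ i) x := by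
    intro i c x
    have : Commute σ (MulAction.toPerm c) := Equiv.ext fun y ↦ hσ c y
    exact Equiv.congr_fun (this.zpow_left i) x
  have hτz : ∀ (i : ℤ) x, π ((σ ^ i) x) = (τ ^ i) (π x) := by
    have hn : ∀ (i : ℕ) x, π ((σ ^ i) x) = (τ ^ i) (π x) := by
      intro i
      induction i with
      | zero => simp
      | succ i ih => intro x; rw [pow_succ, pow_succ, Perm.mul_apply, Perm.mul_apply, ih, hστ]
    intro i x
    obtain ⟨n, rfl | rfl⟩ := i.eq_nat_or_neg
    · simpa using hn n x
    · rw [zpow_neg, zpow_neg, zpow_natCast, zpow_natCast, Perm.eq_inv_iff_eq, ← hn]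
      simp
  let s := Perm.SameCycle.setoid σ
  let t := Perm.SameCycle.setoid τ
  let : MulAction H (Quotient s) :=
    { smul := fun c ↦ Quotient.map (c • ·) fun x y ⟨i, hi⟩ ↦ ⟨i, by rw [hσz, hi]⟩
      one_smul := by rintro ⟨x⟩; exact congrArg (Quotient.mk s) (one_smul H x)
      mul_smul := by rintro c d ⟨x⟩; exact congrArg (Quotient.mk s) (mul_smul c d x) }
  have h1 := MulAction.card_modEq_two_of_odd hH hπ h
  have h2 : Nat.card (Quotient s) ≡ Nat.card (Quotient t) [MOD 2] := by
    have h3 := MulAction.card_modEq_two_of_odd (X := Quotient s) hH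
      (π := Quotient.mk (MulAction.orbitRel H (Quotient s))) Quotient.mk_surjective fun x y ↦ by
        rw [Quotient.eq, MulAction.orbitRel_apply, MulAction.mem_orbit_symm]; rfl
    refine h3.trans (congrArg (· % 2) ?_)
    refine Nat.card_eq_of_surjective_of_ker_eq
      (f := fun x : X ↦ Quotient.mk (MulAction.orbitRel H (Quotient s)) (Quotient.mk s x))
      (g := fun x : X ↦ Quotient.mk t (π x))
      (Quotient.mk_surjective.comp Quotient.mk_surjective) (Quotient.mk_surjective.comp hπ)
      fun x y ↦ ?_
    rw [Quotient.eq, MulAction.orbitRel_apply, MulAction.mem_orbit_symm, Quotient.eq]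
    constructor
    · rintro ⟨c, hc⟩
      obtain ⟨i, hi⟩ : Perm.SameCycle σ (c • x) y := Quotient.exact hc
      refine ⟨i, ?_⟩
      rw [← hτz, h]
      exact ⟨c, by rw [← hi, hσz]⟩
    · rintro ⟨i, hi⟩
      rw [← hτz, h] at hi
      obtain ⟨c, hc⟩ := hi
      exact ⟨c, Quotient.sound ⟨i, by rw [← hc, hσz]⟩⟩
  rw [Perm.sign_eq_neg_one_pow_card_add_card, Perm.sign_eq_neg_one_pow_card_add_card]
  have := h1.add h2
  refine Units.ext ?_
  push_cast
  rw [neg_one_pow_eq_pow_mod_two, this, ← neg_one_pow_eq_pow_mod_two]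

/-! ### The Kronecker symbol and the shape of d_G -/

theorem powPerm_congr {G : Type*} [Group G] [Finite G] {a b : ℤ}
    (ha : IsCoprime a (Nat.card G : ℤ)) (hb : IsCoprime b (Nat.card G : ℤ))
    (h : a ≡ b [ZMOD Nat.card G]) : powPerm (G := G) a ha = powPerm b hb :=
  Equiv.ext fun g ↦ zpow_eq_zpow_iff_modEq.mpr
    (h.of_dvd (Int.natCast_dvd_natCast.mpr (orderOf_dvd_natCard g)))

theorem kroneckerSym_natCast_of_odd (d : ℤ) {b : ℕ} (hb : Odd b) :
    kroneckerSym d b = jacobiSym d b := by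
  have h0 : (b : ℤ) ≠ 0 := by exact_mod_cast hb.pos.ne'
  have hv : padicValNat 2 b = 0 := padicValNat.eq_zero_of_not_dvd (by
    rw [← even_iff_two_dvd]; exact Nat.not_even_iff_odd.mpr hb)
  have hlt : ¬ ((b : ℤ) < 0 ∧ d < 0) := fun h ↦ by omega
  rw [kroneckerSym, if_neg h0, if_neg hlt, Int.natAbs_natCast, hv, pow_zero, pow_zero, Nat.div_one,
    one_mul, one_mul]

theorem jacobiSym_neg_one_pow_mul_self {n m : ℕ} (hn : Odd n) (hm : Odd m) :
    jacobiSym ((-1) ^ ((n - 1) / 2) * n) m = jacobiSym m n := by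
  have h : (n - 1) / 2 = n / 2 := by obtain ⟨k, rfl⟩ := hn; omega
  rw [jacobiSym.quadratic_reciprocity' hm hn, qrSign,
    ZMod.χ₄_eq_neg_one_pow (Nat.odd_iff.mp hn), jacobiSym.mul_left, h]

/-- Quadratic reciprocity with its supplements, applied to the odd part, the power of 2 and the sign
of `a`. It shows that the left side depends only on `a` modulo n. -/
theorem kroneckerSym_neg_one_pow_mul_self {n : ℕ} (hn : Odd n) {a : ℤ}
    (ha : IsCoprime a (n : ℤ)) :
    kroneckerSym ((-1) ^ ((n - 1) / 2) * n) a = jacobiSym a n := by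
  rcases eq_or_ne a 0 with rfl | ha0
  · obtain rfl : n = 1 := by simpa [isCoprime_zero_left, Int.isUnit_iff_natAbs_eq] using ha
    simp [kroneckerSym]
  have hn0 : 0 < n := hn.pos
  have hn1 : n / 2 = (n - 1) / 2 := by obtain ⟨k, hk⟩ := hn; omega
  have hb0 : a.natAbs ≠ 0 := Int.natAbs_ne_zero.mpr ha0
  set v := padicValNat 2 a.natAbs with hv
  set m := a.natAbs / 2 ^ v with hm
  have hbm : a.natAbs = 2 ^ v * m := (Nat.mul_div_cancel' pow_padicValNat_dvd).symm
  have hmodd : Odd m := by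
    rw [← Nat.not_even_iff_odd, even_iff_two_dvd]
    rintro ⟨c, hc⟩
    refine pow_succ_padicValNat_not_dvd (p := 2) hb0 ⟨c, ?_⟩
    rw [← hv, hbm, hc, pow_succ, mul_assoc]
  have hχ : ZMod.χ₈ (((-1) ^ ((n - 1) / 2) * n : ℤ) : ZMod 8) = jacobiSym 2 n := by
    rw [jacobiSym.at_two hn]
    rcases Nat.even_or_odd ((n - 1) / 2) with h | h
    · rw [h.neg_one_pow, one_mul, Int.cast_natCast]
    -- χ₈ is an even character, so the sign of its argument is immaterial.
    · rw [h.neg_one_pow, neg_one_mul, Int.cast_neg, Int.cast_natCast]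
      generalize (n : ZMod 8) = x
      revert x
      decide
  have hJ : jacobiSym (a.natAbs : ℤ) n = jacobiSym 2 n ^ v * jacobiSym m n := by
    rw [hbm, Nat.cast_mul, Nat.cast_pow, jacobiSym.mul_left, jacobiSym.pow_left, Nat.cast_two]
  rw [kroneckerSym, if_neg ha0, ← hv, ← hm, hχ, jacobiSym_neg_one_pow_mul_self hn hmodd, mul_assoc,
    ← hJ]
  rcases lt_or_gt_of_ne ha0 with h | h
  · have hab : a = -(a.natAbs : ℤ) := by omega
    conv_rhs => rw [hab, jacobiSym.neg _ hn]
    congr 1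
    rw [ZMod.χ₄_eq_neg_one_pow (Nat.odd_iff.mp hn), hn1]
    rcases Nat.even_or_odd ((n - 1) / 2) with h | h
    · rw [h.neg_one_pow, if_neg (by omega)]
    · rw [h.neg_one_pow, if_pos (by omega)]
  · have hab : a = (a.natAbs : ℤ) := by omega
    rw [if_neg (by omega), one_mul, ← hab]

/-- The even power of n is a square prime to `a`, so only the sign (-1)^k contributes. -/
theorem kroneckerSym_neg_one_pow_mul_pow_of_even (k : ℕ) {n f : ℕ} (hn0 : n ≠ 0) (hn : Even n)
    (hf : Even f) {a : ℤ} (ha : IsCoprime a (n : ℤ)) :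
    kroneckerSym ((-1) ^ k * n ^ f) a = ZMod.χ₄ (a : ZMod 4) ^ k := by
  have haodd : Odd a := by
    rw [← Int.not_even_iff_odd]
    intro h
    obtain ⟨c, hc⟩ := h
    obtain ⟨e, he⟩ := hn
    obtain ⟨x, y, hxy⟩ := ha
    rw [hc, he] at hxy
    push_cast at hxy
    have : 2 * (x * c + y * e) = 1 := by linear_combination hxy
    omega
  have hb : Odd a.natAbs := Int.natAbs_odd.mpr haodd
  have ha0 : a ≠ 0 := by rintro rfl; simp at haodd
  have hv : padicValNat 2 a.natAbs = 0 := padicValNat.eq_zero_of_not_dvd (by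
    rw [← even_iff_two_dvd]; exact Nat.not_even_iff_odd.mpr hb)
  have hnpos : (0 : ℤ) < n ^ f := by positivity
  have hJn : jacobiSym n a.natAbs ^ f = 1 := by
    obtain ⟨e, rfl⟩ := hf
    rw [← two_mul, pow_mul, jacobiSym.sq_one, one_pow]
    simpa [Int.isCoprime_iff_gcd_eq_one, Int.gcd, Nat.gcd_comm, Int.natAbs_abs] using ha
  rw [kroneckerSym, if_neg ha0, hv, pow_zero, pow_zero, Nat.div_one, mul_one, jacobiSym.mul_left,
    jacobiSym.pow_left _ f, hJn, mul_one, jacobiSym.pow_left, jacobiSym.at_neg_one hb]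
  have hχ : ZMod.χ₄ (a : ZMod 4) = (if a < 0 then -1 else 1) * ZMod.χ₄ (a.natAbs : ZMod 4) := by
    rcases lt_or_gt_of_ne ha0 with h | h
    · rw [if_pos h]
      conv_lhs => rw [show a = -(a.natAbs : ℤ) by omega, Int.cast_neg, Int.cast_natCast]
      generalize (a.natAbs : ZMod 4) = x
      revert x
      decide
    · rw [if_neg h.le.not_gt, one_mul]
      conv_lhs => rw [show a = (a.natAbs : ℤ) by omega, Int.cast_natCast]
  rw [hχ, mul_pow]
  congr 1
  rcases Nat.even_or_odd k with hk | hk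
  · rw [hk.neg_one_pow, if_neg (by omega)]
    split_ifs <;> simp [hk.neg_one_pow]
  · rw [hk.neg_one_pow]
    by_cases h : a < 0
    · rw [if_pos ⟨h, by omega⟩, if_pos h, hk.neg_one_pow]
    · rw [if_neg (fun h' ↦ h h'.1), if_neg h, one_pow]

/-- In the abelian case n_2 = 1; in odd order ε = 0. -/
theorem numSylowTwo_pow_epsTwo {G : Type*} [Group G] [Finite G]
    (hG : (∀ x y : G, x * y = y * x) ∨ Odd (Nat.card G)) : numSylowTwo G ^ epsTwo G = 1 := by
  rcases hG with hG | hG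
  · have P : Sylow 2 G := default
    have hP : (P : Subgroup G).Normal := ⟨fun x hx g ↦ by rwa [hG g x, mul_inv_cancel_right]⟩
    have := Sylow.unique_of_normal P hP
    rw [numSylowTwo, Nat.card_unique, one_pow]
  · rw [epsTwo, if_neg, pow_zero]
    intro h
    rw [h] at hG
    exact Nat.not_odd_iff_even.mpr (even_two_mul _) hG

theorem powDisc_eq {G : Type*} [Group G] [Finite G]
    (hG : (∀ x y : G, x * y = y * x) ∨ Odd (Nat.card G)) :
    powDisc G = (-1) ^ ((Nat.card G - (powKernel G 2).ncard) / 2) *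
      (Nat.card G : ℤ) ^ (powKernel G 2).ncard := by
  rw [powDisc, numSylowTwo_pow_epsTwo hG, Nat.div_one, Nat.cast_pow]

theorem sign_inv_eq {G : Type*} [Group G] [Fintype G] [DecidableEq G] :
    Equiv.Perm.sign (Equiv.inv G) = (-1) ^ ((Nat.card G - (powKernel G 2).ncard) / 2) := by
  rw [Equiv.Perm.sign_of_pow_two_eq_one (by ext g; simp [pow_two]), ← Nat.card_eq_fintype_card,
    ← Nat.card_eq_fintype_card, ← Nat.card_coe_set_eq]
  congr 4
  have : Function.fixedPoints (Equiv.inv G) = powKernel G 2 := by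
    ext g
    simp [powKernel, Function.IsFixedPt, pow_two, inv_eq_iff_mul_eq_one]
  rw [this]

/-! ### The character table in characteristic p -/

section

open Polynomial Matrix

theorem Matrix.trace_pow_char {n K : Type*} [DecidableEq n] [Fintype n] [Field K] (p : ℕ)
    [Fact p.Prime] [CharP K p] (M : Matrix n n K) : trace (M ^ p) = trace M ^ p := by
  cases isEmpty_or_nonempty n
  · simp [Matrix.trace, (Fact.out : p.Prime).ne_zero]
  have hM : expand K p (M ^ p).charpoly = M.charpoly ^ p := by
    unfold charpoly
    rw [AlgHom.map_det, ← coe_detMonoidHom, ← (detMonoidHom : Matrix n n K[X] →* K[X]).map_pow]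
    apply congr_arg det
    refine matPolyEquiv.injective ?_
    rw [map_pow, matPolyEquiv_charmatrix, sub_pow_char_of_commute, ← C_pow]
    · exact (id (matPolyEquiv_eq_X_pow_sub_C p M) :)
    · exact (C M).commute_X
  rw [← map_frobenius_expand, map_expand] at hM
  rw [trace_eq_neg_charpoly_coeff, trace_eq_neg_charpoly_coeff,
    expand_injective (Fact.out : p.Prime).pos hM, coeff_map, frobenius_def, neg_pow]
  rcases (Fact.out : p.Prime).eq_two_or_odd' with rfl | hp
  · simp [CharTwo.neg_eq]
  · simp [hp.neg_one_pow]

/-- Equating this trace with the one on the group algebra, which counts solutions of gxh = x, yields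
column orthogonality. -/
theorem Matrix.trace_pi_mulLeftRight {ι K : Type*} [Fintype ι] [Field K] {d : ι → ℕ}
    (A B : Π i, Matrix (Fin (d i)) (Fin (d i)) K) :
    LinearMap.trace K (Π i, Matrix (Fin (d i)) (Fin (d i)) K) (LinearMap.mulLeftRight K (A, B)) =
      ∑ i, trace (A i) * trace (B i) := by
  classical
  rw [LinearMap.trace_eq_matrix_trace K
    (Pi.basis fun i ↦ Matrix.stdBasis K (Fin (d i)) (Fin (d i)))]
  simp only [trace, diag, Fintype.sum_sigma, Fintype.sum_prod_type, Finset.sum_mul_sum,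
    LinearMap.toMatrix_apply]
  refine Finset.sum_congr rfl fun i _ ↦ Finset.sum_congr rfl fun a _ ↦
    Finset.sum_congr rfl fun b _ ↦ ?_
  simp only [Pi.basis_apply, Matrix.stdBasis_eq_single, LinearMap.mulLeftRight_apply,
    Pi.basis_repr, Pi.mul_apply, Pi.single_eq_same]
  change (A i * single a b 1 * B i : Matrix (Fin (d i)) (Fin (d i)) K) a b = _
  simp [Matrix.mul_apply, single_apply, Finset.sum_ite_eq, ite_and]

theorem MonoidAlgebra.trace_mulLeftRight_single {G K : Type*} [Group G] [Finite G] [Field K]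
    (g h : G) :
    LinearMap.trace K (MonoidAlgebra K G)
      (LinearMap.mulLeftRight K (MonoidAlgebra.single g 1, MonoidAlgebra.single h 1)) =
    Nat.card {x // g * x * h = x} := by
  classical
  have := Fintype.ofFinite G
  rw [LinearMap.trace_eq_matrix_trace K (MonoidAlgebra.basis G K)]
  simp only [trace, diag, LinearMap.toMatrix_apply]
  simp [MonoidAlgebra.basis]
  simp [Finsupp.single_apply, Fintype.card_subtype]

namespace ConjClasses

/-- The order of the centralizer of a representative of a conjugacy class. -/
noncomputable def centralizerCard {G : Type*} [Group G] (C : ConjClasses G) : ℕ :=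
  Nat.card {x : G // Quotient.out C * x = x * Quotient.out C}

theorem card_conjugators {G : Type*} [Group G] (C : ConjClasses G) (h : G) [Decidable (C = .mk h)] :
    Nat.card {x : G // Quotient.out C * x * h⁻¹ = x} =
      if C = .mk h then C.centralizerCard else 0 := by
  have hC : C = .mk (Quotient.out C) := (Quotient.out_eq C).symm
  split_ifs with hh
  · obtain ⟨c, hc⟩ := isConj_iff.mp (mk_eq_mk_iff_isConj.mp (hC.symm.trans hh))
    refine Nat.card_congr ((Equiv.mulRight c).subtypeEquiv fun x ↦ ?_)
    simp only [Equiv.coe_mulRight, ← hc]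
    rw [mul_inv_eq_iff_eq_mul, ← mul_left_inj c]
    simp [mul_assoc]
  · have : IsEmpty {x : G // Quotient.out C * x * h⁻¹ = x} := ⟨fun ⟨x, hx⟩ ↦ hh ?_⟩
    · simp
    · rw [hC, mk_eq_mk_iff_isConj, isConj_comm, isConj_iff]
      exact ⟨x, by rw [mul_inv_eq_iff_eq_mul] at hx ⊢; exact hx.symm⟩

theorem centralizerCard_dvd {G : Type*} [Group G] [Finite G] (C : ConjClasses G) :
    C.centralizerCard ∣ Nat.card G := by
  have : C.centralizerCard = Nat.card (Subgroup.centralizer {Quotient.out C}) :=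
    Nat.card_congr (Equiv.subtypeEquivRight fun x ↦ by
      rw [Subgroup.mem_centralizer_singleton_iff, eq_comm])
  rw [this]
  exact Subgroup.card_subgroup_dvd_card _

end ConjClasses

/-- A character table of `G` over an algebraically closed field of characteristic `p ∤ |G|`: a
square matrix of class functions satisfying column orthogonality, on which the Frobenius acts by
permuting the columns. -/
theorem exists_characterTable {G : Type*} [Group G] [Fintype G] [Fintype (ConjClasses G)]
    [DecidableEq (ConjClasses G)] (K : Type*) [Field K] [IsAlgClosed K] (p : ℕ) [Fact p.Prime]
    [CharP K p] (hp : ((Nat.card G : ℕ) : K) ≠ 0) :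
    ∃ X : Matrix (ConjClasses G) (ConjClasses G) K,
      (∀ i g, X i (.mk (g ^ p)) = X i (.mk g) ^ p) ∧
      ∀ C h, ∑ i, X i C * X i (.mk h⁻¹) = if C = .mk h then (C.centralizerCard : K) else 0 := by
  have : NeZero (Nat.card G : K) := ⟨hp⟩
  obtain ⟨r, d, hd, ⟨e⟩⟩ :=
    IsSemisimpleRing.exists_algEquiv_pi_matrix_of_isAlgClosed K (MonoidAlgebra K G)
  let ρ : G →* (Π i, Matrix (Fin (d i)) (Fin (d i)) K) :=
    (e : MonoidAlgebra K G →* _).comp (MonoidAlgebra.of K G)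
  let R : Matrix (Fin r) (ConjClasses G) K := fun i C ↦ trace (ρ (Quotient.out C) i)
  have hR : ∀ i g, R i (.mk g) = trace (ρ g i) := by
    intro i g
    obtain ⟨c, hc⟩ := isConj_iff.mp (ConjClasses.mk_eq_mk_iff_isConj.mp
      (Quotient.out_eq (ConjClasses.mk g)))
    change trace (ρ _ i) = _
    conv_rhs => rw [← hc, map_mul, Pi.mul_apply, trace_mul_comm, ← Pi.mul_apply, ← map_mul]
    simp
  have horth : ∀ C h, ∑ i, R i C * R i (.mk h⁻¹) =
      if C = .mk h then (C.centralizerCard : K) else 0 := by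
    intro C h
    have h1 := MonoidAlgebra.trace_mulLeftRight_single (K := K) (Quotient.out C) h⁻¹
    rw [← LinearMap.trace_conj' _ e.toLinearEquiv, AlgEquiv.linearEquivConj_mulLeftRight,
      ConjClasses.card_conjugators] at h1
    have h2 := Matrix.trace_pi_mulLeftRight (ρ (Quotient.out C)) (ρ h⁻¹)
    simp only [hR]
    refine h2.symm.trans (h1.trans ?_)
    split_ifs <;> simp
  have hz : ∀ C : ConjClasses G, (C.centralizerCard : K) ≠ 0 := by
    intro C h0
    obtain ⟨m, hm⟩ := C.centralizerCard_dvd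
    exact hp (by rw [hm, Nat.cast_mul, h0, zero_mul])
  -- By orthogonality the columns give an invertible diagonal matrix, whose rank is bounded by the
  -- number r of rows.
  have hle : Fintype.card (ConjClasses G) ≤ r := by
    let R' : Matrix (Fin r) (ConjClasses G) K := fun i C ↦ R i (.mk (Quotient.out C)⁻¹)
    have hRR : Rᵀ * R' = diagonal fun C ↦ (C.centralizerCard : K) := by
      ext C D
      have hD : ConjClasses.mk (Quotient.out D) = D := Quotient.out_eq D
      rw [mul_apply, diagonal_apply]
      conv_rhs => rw [← hD]
      exact horth C (Quotient.out D)
    have h1 : (Rᵀ * R').rank = Fintype.card (ConjClasses G) := by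
      rw [hRR, rank_of_isUnit]
      rw [isUnit_diagonal, Pi.isUnit_iff]
      exact fun C ↦ (hz C).isUnit
    rw [← h1]
    exact (rank_mul_le_right _ _).trans (by simpa using rank_le_card_height R')
  have hge : r ≤ Fintype.card (ConjClasses G) := by
    have hli : LinearIndependent K R := by
      rw [Fintype.linearIndependent_iff]
      intro c hc j
      -- A relation among the characters extends linearly to the whole algebra; evaluating it at a
      -- diagonal matrix unit of block j isolates c j.
      let φ : (Π i, Matrix (Fin (d i)) (Fin (d i)) K) →ₗ[K] K :=
        ∑ i, c i • (traceLinearMap (Fin (d i)) K K ∘ₗ LinearMap.proj i)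
      have hφ : φ ∘ₗ e.toLinearMap = 0 := by
        refine (MonoidAlgebra.basis G K).ext fun g ↦ ?_
        have h0 : ∑ i, c i * R i (.mk g) = 0 := by simpa using congrFun hc (.mk g)
        simp only [hR] at h0
        simpa [φ, ρ] using h0
      have := hd j
      have h1 := LinearMap.congr_fun hφ (e.symm (Pi.single j (single 0 0 1)))
      simp only [LinearMap.comp_apply, AlgEquiv.toLinearMap_apply, AlgEquiv.apply_symm_apply,
        LinearMap.zero_apply, φ, LinearMap.sum_apply, LinearMap.smul_apply, LinearMap.proj_apply,
        traceLinearMap_apply, smul_eq_mul] at h1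
      rw [Finset.sum_eq_single j] at h1
      · simpa using h1
      · intro i _ hi
        rw [Pi.single_eq_of_ne hi, trace_zero, mul_zero]
      · simp
    simpa using hli.fintype_card_le_finrank
  let E : ConjClasses G ≃ Fin r := Fintype.equivOfCardEq (by rw [Fintype.card_fin]; omega)
  refine ⟨R.submatrix E id, fun i g ↦ ?_, fun C h ↦ ?_⟩
  · rw [submatrix_apply, submatrix_apply, id, id, hR, hR, map_pow, Pi.pow_apply, trace_pow_char]
  · rw [← horth C h, ← E.sum_comp]
    rfl

/-- With D = det X ≠ 0, orthogonality gives D² for the base on the left, and Frobenius gives D^p =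
sgn(τ) D; cancel D. -/
theorem sign_mul_prod_centralizerCard_pow {G : Type*} [Group G] [Fintype G]
    [Fintype (ConjClasses G)] [DecidableEq (ConjClasses G)] (K : Type*) [Field K] [IsAlgClosed K]
    (p : ℕ) [Fact p.Prime] [CharP K p] (hp2 : p ≠ 2) (hp : ¬ p ∣ Nat.card G)
    {ι τ : Equiv.Perm (ConjClasses G)}
    (hι : ∀ g, ι (.mk g) = .mk g⁻¹) (hτ : ∀ g, τ (.mk g) = .mk (g ^ p)) :
    (((Equiv.Perm.sign ι : ℤˣ) * ∏ C : ConjClasses G, (C.centralizerCard : ℤ) : ℤ) : K) ^ (p / 2) =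
      ((Equiv.Perm.sign τ : ℤˣ) : ℤ) := by
  have hpK : ((Nat.card G : ℕ) : K) ≠ 0 := by rwa [Ne, CharP.cast_eq_zero_iff K p]
  obtain ⟨X, hX, horth⟩ := exists_characterTable (G := G) K p hpK
  have h1 : Xᵀ * X.submatrix id ι = diagonal fun C ↦ (C.centralizerCard : K) := by
    ext C D
    obtain ⟨h, rfl⟩ := ConjClasses.mk_surjective D
    rw [mul_apply, diagonal_apply, ← horth]
    simp [hι]
  have h2 : X.map (frobenius K p) = X.submatrix id τ := by
    ext i D
    obtain ⟨h, rfl⟩ := ConjClasses.mk_surjective D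
    simp [hτ, hX, frobenius_def]
  replace h1 := congrArg det h1
  replace h2 := congrArg det h2
  rw [det_mul, det_transpose, det_permute', det_diagonal] at h1
  rw [det_permute', ← RingHom.mapMatrix_apply, ← RingHom.map_det, frobenius_def] at h2
  have hdet : X.det ≠ 0 := by
    intro h0
    rw [h0, zero_mul, eq_comm, Finset.prod_eq_zero_iff] at h1
    obtain ⟨C, -, hC⟩ := h1
    obtain ⟨m, hm⟩ := C.centralizerCard_dvd
    exact hpK (by rw [hm, Nat.cast_mul, hC, zero_mul])
  have hodd : 2 * (p / 2) + 1 = p :=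
    Nat.two_mul_div_two_add_one_of_odd ((Fact.out : p.Prime).odd_of_ne_two hp2)
  have hsq : (((Equiv.Perm.sign ι : ℤˣ) : ℤ) : K) * ((Equiv.Perm.sign ι : ℤˣ) : ℤ) = 1 := by
    rw [← Int.cast_mul, Int.units_coe_mul_self, Int.cast_one]
  have h4 : (((Equiv.Perm.sign ι : ℤˣ) * ∏ C : ConjClasses G, (C.centralizerCard : ℤ) : ℤ) : K) =
      X.det ^ 2 := by
    push_cast
    rw [← h1]
    linear_combination X.det ^ 2 * hsq
  refine mul_right_cancel₀ hdet ?_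
  rw [h4, ← pow_mul, ← pow_succ, hodd, h2]

theorem legendreSym_eq_sign_of_conjClasses {G : Type*} [Group G] [Fintype G]
    [Fintype (ConjClasses G)] [DecidableEq (ConjClasses G)] (p : ℕ) [Fact p.Prime] (hp2 : p ≠ 2)
    (hp : ¬ p ∣ Nat.card G) {ι τ : Equiv.Perm (ConjClasses G)}
    (hι : ∀ g, ι (.mk g) = .mk g⁻¹) (hτ : ∀ g, τ (.mk g) = .mk (g ^ p)) :
    legendreSym p ((Equiv.Perm.sign ι : ℤˣ) * ∏ C : ConjClasses G, (C.centralizerCard : ℤ)) =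
      (Equiv.Perm.sign τ : ℤˣ) := by
  have : CharP (AlgebraicClosure (ZMod p)) p := charP_of_injective_algebraMap
    (algebraMap (ZMod p) (AlgebraicClosure (ZMod p))).injective p
  have h := sign_mul_prod_centralizerCard_pow (AlgebraicClosure (ZMod p)) p hp2 hp hι hτ
  generalize ((Equiv.Perm.sign ι : ℤˣ) * ∏ C : ConjClasses G, (C.centralizerCard : ℤ) : ℤ) = m at *
  rw [← map_intCast (algebraMap (ZMod p) (AlgebraicClosure (ZMod p))),
    ← map_intCast (algebraMap (ZMod p) (AlgebraicClosure (ZMod p))), ← map_pow,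
    ← legendreSym.eq_pow] at h
  replace h := (algebraMap (ZMod p) (AlgebraicClosure (ZMod p))).injective h
  have : Fact (2 < p) := ⟨(Fact.out : p.Prime).two_le.lt_of_ne' hp2⟩
  have hne : (-1 : ZMod p) ≠ 1 := ZMod.neg_one_ne_one
  have h6 : legendreSym p m = 0 ∨ legendreSym p m = 1 ∨ legendreSym p m = -1 :=
    quadraticChar_isQuadratic (ZMod p) m
  generalize legendreSym p m = l at h h6
  rcases Int.units_eq_one_or (Equiv.Perm.sign τ) with hs | hs <;> rw [hs] at h ⊢ <;>
    rcases h6 with rfl | rfl | rfl <;> simp [hne, hne.symm] at h ⊢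

end

/-! ### From conjugacy classes to elements -/

/-- The permutation of the conjugacy classes induced by a permutation of the group that commutes
with conjugation. -/
def ConjClasses.congrPerm {G : Type*} [Group G] (σ : Perm G)
    (hσ : ∀ c g, σ (c * g * c⁻¹) = c * σ g * c⁻¹) : Perm (ConjClasses G) :=
  Quotient.congr σ fun x y ↦ by
    change IsConj x y ↔ IsConj (σ x) (σ y)
    simp only [isConj_iff, ← hσ, σ.injective.eq_iff]

theorem ConjClasses.sign_congrPerm {G : Type*} [Group G] [Fintype G] [DecidableEq G]
    [Fintype (ConjClasses G)] [DecidableEq (ConjClasses G)]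
    (hG : (∀ x y : G, x * y = y * x) ∨ Odd (Nat.card G)) (σ : Perm G)
    (hσ : ∀ c g, σ (c * g * c⁻¹) = c * σ g * c⁻¹) :
    Perm.sign (ConjClasses.congrPerm σ hσ) = Perm.sign σ := by
  -- Acting through inner automorphisms, not G itself, covers abelian groups of even order: there
  -- the acting group is trivial.
  have hodd : Odd (Nat.card (MulAut.conj (G := G)).range) := by
    rcases hG with hG | hG
    · have : (MulAut.conj (G := G)) = 1 := by
        ext c g
        rw [MulAut.conj_apply, hG c g, mul_inv_cancel_right]
        rfl
      rw [this, MonoidHom.range_one, Subgroup.card_bot]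
      exact odd_one
    · exact hG.of_dvd_nat (Subgroup.card_range_dvd _)
  refine (Perm.sign_eq_sign_of_odd_action hodd ConjClasses.mk_surjective (fun x y ↦ ?_) ?_
    fun x ↦ rfl).symm
  · rw [ConjClasses.mk_eq_mk_iff_isConj, isConj_iff]
    constructor
    · rintro ⟨c, hc⟩
      exact ⟨⟨_, c, rfl⟩, hc⟩
    · rintro ⟨⟨_, c, rfl⟩, hc⟩
      exact ⟨c, hc⟩
  · rintro ⟨_, c, rfl⟩ x
    exact hσ c x

theorem eq_one_of_sq_eq_one_of_odd {G : Type*} [Group G] (hG : Odd (Nat.card G)) {g : G}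
    (h : g ^ 2 = 1) : g = 1 :=
  (powCoprime hG.coprime_two_right).injective (h.trans (one_pow 2).symm)

/-- If c inverts g, then c² commutes with g. In odd order c is a power of c², so c commutes with g
too, and g = g⁻¹. -/
theorem ConjClasses.eq_one_of_eq_inv {G : Type*} [Group G] (hG : Odd (Nat.card G)) {g : G}
    (h : ConjClasses.mk g⁻¹ = ConjClasses.mk g) : g = 1 := by
  obtain ⟨c, hc⟩ := isConj_iff.mp (ConjClasses.mk_eq_mk_iff_isConj.mp h)
  have hc' : c * g * c⁻¹ = g⁻¹ := by rw [← conj_inv, inv_eq_iff_eq_inv] at hc; exact hc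
  have h2 : Commute (c ^ 2) g := by
    have : c * (c * g * c⁻¹) * c⁻¹ = g := by rw [hc', hc]
    rw [commute_iff_eq, ← mul_inv_eq_iff_eq_mul]
    simpa [sq, mul_assoc] using this
  have hcg : Commute c g := by
    obtain ⟨k, hk⟩ := hG
    have : c = (c ^ 2) ^ (k + 1) := by
      rw [← pow_mul, show 2 * (k + 1) = Nat.card G + 1 by omega, pow_succ, pow_card_eq_one', one_mul]
    rw [this]
    exact h2.pow_left _
  refine eq_one_of_sq_eq_one_of_odd hG ?_
  rw [hcg.eq, mul_inv_cancel_right] at hc'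
  rw [sq]
  nth_rw 2 [hc']
  exact mul_inv_cancel g

theorem ConjClasses.centralizerCard_mk {G : Type*} [Group G] (g : G) :
    (ConjClasses.mk g).centralizerCard = Nat.card {x : G // Commute g x} := by
  obtain ⟨c, hc⟩ := isConj_iff.mp (ConjClasses.mk_eq_mk_iff_isConj.mp
    (Quotient.out_eq (ConjClasses.mk g)))
  refine Nat.card_congr ((MulAut.conj c).toEquiv.subtypeEquiv fun x ↦ ?_)
  change _ ↔ g * (c * x * c⁻¹) = c * x * c⁻¹ * g
  conv_rhs => rw [← hc]
  simp only [mul_assoc, inv_mul_cancel_left, mul_right_inj]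
  rw [← mul_assoc, ← mul_assoc, mul_left_inj]

theorem ConjClasses.centralizerCard_mk_inv {G : Type*} [Group G] (g : G) :
    (ConjClasses.mk g⁻¹).centralizerCard = (ConjClasses.mk g).centralizerCard := by
  simp only [ConjClasses.centralizerCard_mk, Commute.inv_left_iff]

/-- In the abelian case there are |G| factors, all equal to |G|. In odd order the nontrivial classes
pair off as C, C⁻¹ with equal centralizer orders, leaving only the factor |G| of the trivial class.
-/
theorem legendreSym_prod_centralizerCard {G : Type*} [Group G] [Fintype G]
    [Fintype (ConjClasses G)] (hG : (∀ x y : G, x * y = y * x) ∨ Odd (Nat.card G))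
    (p : ℕ) [Fact p.Prime] (hp : ¬ p ∣ Nat.card G) :
    legendreSym p (∏ C : ConjClasses G, (C.centralizerCard : ℤ)) =
      legendreSym p (Nat.card G) ^ Nat.card G := by
  classical
  have hn : ((Nat.card G : ℤ) : ZMod p) ≠ 0 := by
    rwa [Int.cast_natCast, Ne, CharP.cast_eq_zero_iff (ZMod p) p]
  have hz1 : (ConjClasses.mk (1 : G)).centralizerCard = Nat.card G := by
    rw [ConjClasses.centralizerCard_mk]
    exact Nat.card_congr (Equiv.subtypeUnivEquiv Commute.one_left)
  have hmap : legendreSym p (∏ C : ConjClasses G, (C.centralizerCard : ℤ)) =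
      ∏ C : ConjClasses G, legendreSym p C.centralizerCard :=
    map_prod (legendreSym.hom p) _ _
  rw [hmap]
  rcases hG with hG | hG
  · have hz : ∀ C : ConjClasses G, C.centralizerCard = Nat.card G := fun C ↦
      Nat.card_congr (Equiv.subtypeUnivEquiv fun x ↦ hG _ x)
    have hk : Nat.card G = Nat.card (ConjClasses G) := by
      refine Nat.card_eq_of_bijective _ ⟨fun x y h ↦ ?_, ConjClasses.mk_surjective⟩
      obtain ⟨c, hc⟩ := isConj_iff.mp (ConjClasses.mk_eq_mk_iff_isConj.mp h)
      rwa [hG c x, mul_inv_cancel_right] at hc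
    simp only [hz, Finset.prod_const, Finset.card_univ]
    rw [← Nat.card_eq_fintype_card, ← hk]
  · have hpow : legendreSym p (Nat.card G) ^ Nat.card G = legendreSym p (Nat.card G) := by
      obtain ⟨k, hk⟩ := hG
      calc legendreSym p (Nat.card G) ^ Nat.card G
          = legendreSym p (Nat.card G) ^ (2 * k + 1) := by rw [← hk]
        _ = _ := by rw [pow_succ, pow_mul, legendreSym.sq_one p hn, one_pow, one_mul]
    rw [hpow, ← Finset.mul_prod_erase _ _ (Finset.mem_univ (ConjClasses.mk (1 : G))), hz1]
    convert mul_one _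
    let ι := ConjClasses.congrPerm (Equiv.inv G) fun c g ↦ by simp [mul_assoc]
    have hι : ∀ g : G, ι (.mk g) = .mk g⁻¹ := fun g ↦ rfl
    refine Finset.prod_involution (fun C _ ↦ ι C) ?_ ?_ ?_ ?_
    · intro C _
      obtain ⟨g, rfl⟩ := ConjClasses.mk_surjective C
      rw [hι, ConjClasses.centralizerCard_mk_inv, ← sq, legendreSym.sq_one]
      obtain ⟨m, hm⟩ := (ConjClasses.mk g).centralizerCard_dvd
      intro h0
      exact hn (by rw [hm, Nat.cast_mul, Int.cast_mul, h0, zero_mul])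
    · intro C hC _ h
      obtain ⟨g, rfl⟩ := ConjClasses.mk_surjective C
      exact (Finset.mem_erase.mp hC).1 (by rw [ConjClasses.eq_one_of_eq_inv hG h])
    · intro C hC
      obtain ⟨g, rfl⟩ := ConjClasses.mk_surjective C
      refine Finset.mem_erase.mpr ⟨fun h ↦ (Finset.mem_erase.mp hC).1 ?_, Finset.mem_univ _⟩
      rw [hι, ConjClasses.mk_eq_mk_iff_isConj, isConj_comm, isConj_one_right, inv_eq_one] at h
      rw [h]
    · intro C _
      obtain ⟨g, rfl⟩ := ConjClasses.mk_surjective C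
      rw [hι, hι, inv_inv]

/-! ### Prime exponents, then all exponents by Dirichlet's theorem -/

theorem IsCoprime.of_modEq_left {a b n : ℤ} (ha : IsCoprime a n) (h : a ≡ b [ZMOD n]) :
    IsCoprime b n := by
  obtain ⟨t, ht⟩ := h.dvd
  rw [show b = a + n * t by omega]
  exact ha.add_mul_left_left t

theorem elemSymbol_prime {G : Type*} [Group G] [Fintype G] [DecidableEq G]
    (hG : (∀ x y : G, x * y = y * x) ∨ Odd (Nat.card G)) (p : ℕ) [Fact p.Prime] (hp2 : p ≠ 2)
    (hp : IsCoprime (p : ℤ) (Nat.card G : ℤ)) :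
    elemSymbol G p hp = legendreSym p (powDisc G) := by
  classical
  have hdvd : ¬ p ∣ Nat.card G :=
    ((Fact.out : p.Prime).coprime_iff_not_dvd).mp (Nat.isCoprime_iff_coprime.mp hp)
  have hn : ((Nat.card G : ℤ) : ZMod p) ≠ 0 := by
    rwa [Int.cast_natCast, Ne, CharP.cast_eq_zero_iff (ZMod p) p]
  have hι : ∀ c g : G, Equiv.inv G (c * g * c⁻¹) = c * Equiv.inv G g * c⁻¹ := fun c g ↦ by
    simp [mul_assoc]
  have hτ : ∀ c g : G, powPerm (p : ℤ) hp (c * g * c⁻¹) = c * powPerm (p : ℤ) hp g * c⁻¹ :=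
    fun c g ↦ conj_zpow
  have h := legendreSym_eq_sign_of_conjClasses p hp2 hdvd (ι := ConjClasses.congrPerm _ hι)
    (τ := ConjClasses.congrPerm _ hτ) (fun g ↦ rfl)
    (fun g ↦ congrArg ConjClasses.mk (zpow_natCast g p))
  rw [ConjClasses.sign_congrPerm hG, ConjClasses.sign_congrPerm hG, legendreSym.mul,
    legendreSym_prod_centralizerCard hG p hdvd, sign_inv_eq] at h
  rw [elemSymbol, ← h, powDisc_eq hG, legendreSym.mul]
  have hpow : legendreSym p ((Nat.card G : ℤ) ^ (powKernel G 2).ncard) =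
      legendreSym p (Nat.card G) ^ (powKernel G 2).ncard := map_pow (legendreSym.hom p) _ _
  obtain ⟨k, hk⟩ := exists_card_eq_powKernel_two G
  have hpow2 : legendreSym p (Nat.card G) ^ Nat.card G =
      legendreSym p (Nat.card G) ^ (powKernel G 2).ncard := by
    conv_lhs => rw [hk]
    rw [pow_add, pow_mul, ← hk, legendreSym.sq_one p hn, one_pow, mul_one]
  rw [hpow, hpow2]
  push_cast
  rfl

theorem mainTheorem3 {G : Type*} [Group G] [Fintype G] [DecidableEq G]
    (hG : (∀ x y : G, x * y = y * x) ∨ Odd (Nat.card G))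
    (a : ℤ) (ha : IsCoprime a (Nat.card G : ℤ)) :
    elemSymbol G a ha = kroneckerSym (powDisc G) a := by
  have hn0 : Nat.card G ≠ 0 := Nat.card_pos.ne'
  obtain ⟨k, hk⟩ := exists_card_eq_powKernel_two G
  rcases Nat.even_or_odd (Nat.card G) with hn | hn
  · have hf : Even (powKernel G 2).ncard := by
      rw [hk, Nat.even_add] at hn
      exact hn.mpr (even_two_mul k)
    -- The factor 4 makes the prime agree with `a` under χ₄, which |G| alone need not ensure.
    have ha4 : IsCoprime a ((4 * Nat.card G : ℕ) : ℤ) := by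
      have h2 : IsCoprime a 2 := ha.of_isCoprime_of_dvd_right
        (by exact_mod_cast even_iff_two_dvd.mp hn)
      rw [Nat.cast_mul, show ((4 : ℕ) : ℤ) = 2 * 2 from rfl]
      exact (h2.mul_right h2).mul_right ha
    obtain ⟨p, hp2, hp, hpa⟩ := Nat.forall_exists_prime_gt_and_zmodEq 2
      (mul_ne_zero four_ne_zero hn0) ha4
    have := Fact.mk hp
    have hpa' : a ≡ p [ZMOD Nat.card G] :=
      (hpa.of_dvd (Int.natCast_dvd_natCast.mpr (dvd_mul_left _ _))).symm
    have hpa4 : a ≡ p [ZMOD (4 : ℕ)] :=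
      (hpa.of_dvd (Int.natCast_dvd_natCast.mpr (dvd_mul_right _ _))).symm
    have hpc : IsCoprime (p : ℤ) (Nat.card G : ℤ) := ha.of_modEq_left hpa'
    have h : elemSymbol G a ha = elemSymbol G p hpc := by
      rw [elemSymbol, elemSymbol, powPerm_congr ha hpc hpa']
    rw [h, elemSymbol_prime hG p hp2.ne' hpc, jacobiSym.legendreSym.to_jacobiSym,
      ← kroneckerSym_natCast_of_odd _ (hp.odd_of_ne_two hp2.ne'), powDisc_eq hG,
      kroneckerSym_neg_one_pow_mul_pow_of_even _ hn0 hn hf hpc,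
      kroneckerSym_neg_one_pow_mul_pow_of_even _ hn0 hn hf ha,
      (ZMod.intCast_eq_intCast_iff _ _ _).mpr hpa4]
  · have hf : (powKernel G 2).ncard = 1 := by
      rw [Set.ncard_eq_one]
      refine ⟨1, Set.ext fun g ↦ ⟨eq_one_of_sq_eq_one_of_odd hn, ?_⟩⟩
      rintro rfl
      exact one_pow 2
    obtain ⟨p, hp2, hp, hpa⟩ := Nat.forall_exists_prime_gt_and_zmodEq 2 hn0 ha
    have := Fact.mk hp
    have hpc : IsCoprime (p : ℤ) (Nat.card G : ℤ) := ha.of_modEq_left hpa.symm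
    have h : elemSymbol G a ha = elemSymbol G p hpc := by
      rw [elemSymbol, elemSymbol, powPerm_congr ha hpc hpa.symm]
    rw [h, elemSymbol_prime hG p hp2.ne' hpc, jacobiSym.legendreSym.to_jacobiSym, powDisc_eq hG,
      hf, pow_one, kroneckerSym_neg_one_pow_mul_self hn ha,
      jacobiSym_neg_one_pow_mul_self hn (hp.odd_of_ne_two hp2.ne')]
    exact jacobiSym.mod_left' hpa
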